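/- \textbf{Theorem.} Let $m\ge 1$ and let $\boldsymbol Y_1,\dots,\boldsymbol Y_m$ be random vectors in $\mathbb R^q$ with finite second moments and positive definite variance-covariance matrices $V_1,\dots,V_m$. For each $p\in[m]=\{1,\dots,m\}$ let $\boldsymbol Y_{p1},\boldsymbol Y_{p2},\dots$ be i.i.d. copies of $\boldsymbol Y_p$, the sequences for different $p$ being mutually independent. For sample sizes $n_1,\dots,n_m$ put $n=\frac1m\sum_{p=1}^m n_p$, and for $\boldsymbol\mu\in\mathbb R^q$ define the multi-sample empirical likelihood ratio $$R(\boldsymbol\mu)=\max\Big\{\prod_{p=1}^m\prod_{j=1}^{n_p} n_p w_{pj}\;:\;\sum_{p=1}^m\sum_{j=1}^{n_p}\boldsymbol Y_{pj}w_{pj}=\boldsymbol\mu,\ \ \boldsymbol w_p\in\Delta_{n_p},\ p\in[m]\Big\},$$ where $\Delta_s=\{\boldsymbol v\in\mathbb R^s:\boldsymbol v\ge 0,\ \sum_j v_j=1\}$, and $R(\boldsymbol\mu)=0$ if there are no such weights. Let $\bar{\boldsymbol\mu}=\sum_{p=1}^m \mathrm E[\boldsymbol Y_p]$. Suppose that the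 sample sizes vary along a sequence with $n\to\infty$ such that, for each $p\in[m]$, $n_p/n\to\beta_p$ for some $\beta_p>0$. Then $$-2\log R(\bar{\boldsymbol\mu})\ \xrightarrow{D}\ \chi^2_q ,$$ the chi-square distribution with $q$ degrees of freedom (the law of the sum of squares of $q$ independent standard normal variables). Here $\log 0=-\infty$, so that $-2\log R(\bar{\boldsymbol\mu})$ takes values in $[0,\infty]$, and convergence in distribution is weak convergence of laws on $[-\infty,\infty]$. -/

import Mathlib

open MeasureTheory ProbabilityTheory Filter Topology

namespace MultiEL

noncomputable section

/-- The variance-covariance matrix of a random vector `X` in `ℝ^q`. -/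
def covMatrix {q : ℕ} {Ω : Type*} [MeasurableSpace Ω] (P : Measure Ω)
    (X : Ω → EuclideanSpace ℝ (Fin q)) : Matrix (Fin q) (Fin q) ℝ :=
  Matrix.of fun i k => cov[fun ω => X ω i, fun ω => X ω k; P]

/-- The chi-square distribution with `q` degrees of freedom: the law of the sum of squares of
`q` independent standard normal variables. -/
def chiSquare (q : ℕ) : Measure ℝ :=
  (Measure.pi fun _ : Fin q => gaussianReal 0 1).map fun z => ∑ i, z i ^ 2

instance isProbabilityMeasure_chiSquare (q : ℕ) : IsProbabilityMeasure (chiSquare q) :=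
  Measure.isProbabilityMeasure_map (Measurable.aemeasurable (by fun_prop))

/-- The weights `w_{pj}`, one probability vector for each of the `m` samples, for which the sum
of the weighted means of the data `y_{pj}` equals `μ`. -/
def weights {m q : ℕ} (n : Fin m → ℕ) (y : (p : Fin m) → Fin (n p) → EuclideanSpace ℝ (Fin q))
    (μ : EuclideanSpace ℝ (Fin q)) : Set ((p : Fin m) → Fin (n p) → ℝ) :=
  {w | (∀ p, w p ∈ stdSimplex ℝ (Fin (n p))) ∧ ∑ p, ∑ j, w p j • y p j = μ}

/-- The likelihood ratio `∏_p ∏_j n_p w_{pj}`. -/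
def likelihoodRatio {m : ℕ} (n : Fin m → ℕ) (w : (p : Fin m) → Fin (n p) → ℝ) : ℝ :=
  ∏ p, ∏ j, ((n p : ℝ) * w p j)

/-- The multi-sample empirical likelihood ratio `R(μ)` of the data `y`: the maximum of the
likelihood ratio over the admissible weights, which is `0` if there are none. -/
def elRatio {m q : ℕ} (n : Fin m → ℕ) (y : (p : Fin m) → Fin (n p) → EuclideanSpace ℝ (Fin q))
    (μ : EuclideanSpace ℝ (Fin q)) : ℝ :=
  sSup (likelihoodRatio n '' weights n y μ)

/-- The supremum that defines `R(μ)` is a maximum whenever admissible weights exist. -/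
theorem elRatio_isGreatest {m q : ℕ} (n : Fin m → ℕ)
    (y : (p : Fin m) → Fin (n p) → EuclideanSpace ℝ (Fin q)) (μ : EuclideanSpace ℝ (Fin q))
    (h : (weights n y μ).Nonempty) :
    IsGreatest (likelihoodRatio n '' weights n y μ) (elRatio n y μ) := by
  have hc : IsCompact (weights n y μ) := by
    have h1 : IsCompact (Set.univ.pi fun p : Fin m => stdSimplex ℝ (Fin (n p))) :=
      isCompact_univ_pi fun p => isCompact_stdSimplex ℝ (Fin (n p))
    have h2 : IsClosed {w : (p : Fin m) → Fin (n p) → ℝ | ∑ p, ∑ j, w p j • y p j = μ} :=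
      isClosed_eq (by fun_prop) continuous_const
    have h3 := h1.inter_right h2
    have h4 : weights n y μ = (Set.univ.pi fun p : Fin m => stdSimplex ℝ (Fin (n p))) ∩
        {w : (p : Fin m) → Fin (n p) → ℝ | ∑ p, ∑ j, w p j • y p j = μ} := by
      ext w; simp [weights]
    rwa [h4]
  have hf : Continuous (likelihoodRatio n) := by
    unfold likelihoodRatio; fun_prop
  exact (hc.image hf).isGreatest_sSup (h.image _)

/-- `-2 log R(μ)` with values in `[-∞, ∞]`, where `log 0 = -∞`. -/
def negTwoLogEL {m q : ℕ} (n : Fin m → ℕ)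
    (y : (p : Fin m) → Fin (n p) → EuclideanSpace ℝ (Fin q))
    (μ : EuclideanSpace ℝ (Fin q)) : EReal :=
  (-2 : EReal) * ENNReal.log (ENNReal.ofReal (elRatio n y μ))

/-- The average sample size `(1/m) ∑_p n_p`. -/
def avgSize {m : ℕ} (n : Fin m → ℕ) : ℝ := (1 / (m : ℝ)) * ∑ p, (n p : ℝ)

end

end MultiEL

namespace MultiEL

/-! Everything rests on a two-sided bound for log R that involves no randomness and no Lagrange
multipliers for the exact maximizer. Centre the data so that the target is 0, and let v solve the
linearized optimality equation `hv`. The tilts u_{pj} = -⟨y_{pj} - ȳ_p, v⟩ / n_p then make the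
weights (1 + u_{pj}) / n_p admissible exactly, which bounds R below (`le_log_elRatio`). The same
u_{pj} give a weak-duality bound for every admissible w (`log_elRatio_le`). Both bounds are -Q/2 up
to a relative error of order max |u_{pj}|, where Q = ⟨∑ ȳ_p, v⟩.

With a the average sample size, Q = ⟨Z, M⁻¹ Z⟩ for Z = √a ∑ ȳ_p and M = ∑ (a / n_p) S_p, S_p being
the sample covariance. Injective linear maps preserve the admissible weights (`weights_affine`), so
∑ V_p / β_p may be taken to be the identity. Then M → 1 and max_j ‖y_{pj}‖ = o(√n_p) almost surely
by the strong law, and Z is asymptotically standard normal by the central limit theorem. As Z is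
bounded in probability, -2 log R - ‖Z‖² → 0 in probability, and ‖Z‖² has the chi-square limit. R may
vanish, but only with probability tending to 0 (`tendstoInDistribution_ereal`). -/

/-- The mean of a finite family of vectors. -/
noncomputable def sampleMean {q k : ℕ} (y : Fin k → EuclideanSpace ℝ (Fin q)) :
    EuclideanSpace ℝ (Fin q) := (k : ℝ)⁻¹ • ∑ j, y j

theorem sum_sub_sampleMean {q k : ℕ} (y : Fin k → EuclideanSpace ℝ (Fin q)) :
    ∑ j, (y j - sampleMean y) = 0 := by
  rcases Nat.eq_zero_or_pos k with rfl | hk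
  · simp
  · have : (k : ℝ) ≠ 0 := by positivity
    simp [sampleMean, Finset.sum_sub_distrib, ← Nat.cast_smul_eq_nsmul ℝ, smul_smul, this]

/-- The Taylor remainder |u|³ / (1 - |u|) is at most 2δu² because 1 - |u| ≥ 1/2. Keeping the factor
u² lets the errors sum to a multiple of ∑ u² = Q. -/
theorem abs_log_one_sub_add_le {u δ : ℝ} (hu : |u| ≤ δ) (hδ : δ ≤ 1 / 2) :
    |Real.log (1 - u) + u + u ^ 2 / 2| ≤ 2 * δ * u ^ 2 := by
  have h1 := Real.abs_log_sub_add_sum_range_le (x := u) (by linarith) 2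
  simp only [Finset.sum_range_succ, Finset.sum_range_zero] at h1
  have h2 : |u| ^ (2 + 1) / (1 - |u|) ≤ 2 * δ * u ^ 2 := by
    rw [div_le_iff₀ (by linarith)]
    have h3 : |u| ^ (2 + 1) = |u| * u ^ 2 := by rw [pow_succ, sq_abs]; ring
    rw [h3]
    have : |u| ≤ 2 * δ * (1 - |u|) := by nlinarith [abs_nonneg u]
    nlinarith [sq_nonneg u]
  refine le_trans (le_of_eq ?_) (h1.trans h2)
  congr 1
  norm_num
  ring

/-! ### Deterministic two-sided bound for log R(0) -/

section Bounds

variable {m q : ℕ} (n : Fin m → ℕ) (y : (p : Fin m) → Fin (n p) → EuclideanSpace ℝ (Fin q))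
  (v : EuclideanSpace ℝ (Fin q))

/-- The first-order perturbation of the uniform weights in direction `v`. -/
noncomputable def tilt (p : Fin m) (j : Fin (n p)) : ℝ :=
  -(inner ℝ (y p j - sampleMean (y p)) v / n p)

/-- The quadratic form that approximates `-2 log R(0)`. -/
noncomputable def quadStat : ℝ := inner ℝ (∑ p, sampleMean (y p)) v

theorem sum_tilt (p : Fin m) : ∑ j, tilt n y v p j = 0 := by
  simp only [tilt, Finset.sum_neg_distrib, ← Finset.sum_div, ← sum_inner, sum_sub_sampleMean]
  simp

variable {n y v}

/-- Since the tilts sum to zero in each sample, `y p j` may be centred in the tilted part; `hv` then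
says that this part cancels the sum of the sample means. -/
theorem sum_tilt_smul
    (hv : ∑ p, ((n p : ℝ)⁻¹ ^ 2) • ∑ j, (inner ℝ (y p j - sampleMean (y p)) v : ℝ) •
      (y p j - sampleMean (y p)) = ∑ p, sampleMean (y p)) :
    ∑ p, ∑ j, ((1 + tilt n y v p j) / n p) • y p j = 0 := by
  have h : ∀ p, ∑ j, ((1 + tilt n y v p j) / n p) • y p j = sampleMean (y p) -
      ((n p : ℝ)⁻¹ ^ 2) • ∑ j, (inner ℝ (y p j - sampleMean (y p)) v : ℝ) •
      (y p j - sampleMean (y p)) := by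
    intro p
    have h1 : ∑ j, tilt n y v p j • sampleMean (y p) = 0 := by
      rw [← Finset.sum_smul, sum_tilt, zero_smul]
    have h2 : ∑ j, ((1 + tilt n y v p j) / n p) • y p j = sampleMean (y p) +
        (n p : ℝ)⁻¹ • ∑ j, (tilt n y v p j • (y p j - sampleMean (y p))) := by
      simp only [smul_sub, Finset.sum_sub_distrib, h1, sub_zero]
      rw [sampleMean, ← smul_add, ← Finset.sum_add_distrib, Finset.smul_sum]
      refine Finset.sum_congr rfl fun j _ => ?_
      rw [div_eq_inv_mul, mul_smul, add_smul, one_smul]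
    rw [h2, sub_eq_add_neg, pow_two, mul_smul, ← smul_neg]
    congr 2
    rw [Finset.smul_sum, ← Finset.sum_neg_distrib]
    refine Finset.sum_congr rfl fun j _ => ?_
    rw [tilt, smul_smul, ← neg_smul, div_eq_inv_mul]
  simp only [h, Finset.sum_sub_distrib, hv, sub_self]

/-- This is `hv` paired with `v`. -/
theorem sum_tilt_sq
    (hv : ∑ p, ((n p : ℝ)⁻¹ ^ 2) • ∑ j, (inner ℝ (y p j - sampleMean (y p)) v : ℝ) •
      (y p j - sampleMean (y p)) = ∑ p, sampleMean (y p)) :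
    ∑ p, ∑ j, tilt n y v p j ^ 2 = quadStat n y v := by
  rw [quadStat, ← hv, sum_inner]
  refine Finset.sum_congr rfl fun p _ => ?_
  rw [real_inner_smul_left, sum_inner, Finset.mul_sum]
  refine Finset.sum_congr rfl fun j _ => ?_
  rw [real_inner_smul_left, tilt, div_eq_mul_inv]
  ring

theorem tilt_mem_weights (hn : ∀ p, 0 < n p)
    (hv : ∑ p, ((n p : ℝ)⁻¹ ^ 2) • ∑ j, (inner ℝ (y p j - sampleMean (y p)) v : ℝ) •
      (y p j - sampleMean (y p)) = ∑ p, sampleMean (y p))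
    (hu : ∀ p j, |tilt n y v p j| ≤ 1) :
    (fun p j => (1 + tilt n y v p j) / n p) ∈ weights n y 0 := by
  refine ⟨fun p => ⟨fun j => ?_, ?_⟩, sum_tilt_smul hv⟩
  · have := (abs_le.1 (hu p j)).1
    exact div_nonneg (by linarith) (by positivity)
  · have : (n p : ℝ) ≠ 0 := by exact_mod_cast (hn p).ne'
    rw [← Finset.sum_div, Finset.sum_add_distrib, sum_tilt]
    simp [this]

theorem le_log_elRatio (hn : ∀ p, 0 < n p)
    (hv : ∑ p, ((n p : ℝ)⁻¹ ^ 2) • ∑ j, (inner ℝ (y p j - sampleMean (y p)) v : ℝ) •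
      (y p j - sampleMean (y p)) = ∑ p, sampleMean (y p))
    {δ : ℝ} (hδ : δ ≤ 1 / 2) (hu : ∀ p j, |tilt n y v p j| ≤ δ) :
    0 < elRatio n y 0 ∧
      -(quadStat n y v) / 2 - 2 * δ * quadStat n y v ≤ Real.log (elRatio n y 0) := by
  have hw := tilt_mem_weights hn hv fun p j => (hu p j).trans (by linarith)
  have hle : ∏ p, ∏ j, (1 + tilt n y v p j) ≤ elRatio n y 0 := by
    have h := (elRatio_isGreatest n y 0 ⟨_, hw⟩).2 ⟨_, hw, rfl⟩
    refine le_trans (le_of_eq ?_) h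
    refine Finset.prod_congr rfl fun p _ => Finset.prod_congr rfl fun j _ => ?_
    have : (n p : ℝ) ≠ 0 := by exact_mod_cast (hn p).ne'
    field_simp
  have hpos : ∀ p j, 0 < 1 + tilt n y v p j := fun p j => by
    have := (abs_le.1 (hu p j)).1
    linarith
  have hpos' : 0 < ∏ p, ∏ j, (1 + tilt n y v p j) :=
    Finset.prod_pos fun p _ => Finset.prod_pos fun j _ => hpos p j
  refine ⟨hpos'.trans_le hle, le_trans ?_ (Real.log_le_log hpos' hle)⟩
  rw [Real.log_prod fun p _ => (Finset.prod_pos fun j _ => hpos p j).ne']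
  have h1 : ∀ p, Real.log (∏ j, (1 + tilt n y v p j)) = ∑ j, Real.log (1 + tilt n y v p j) :=
    fun p => Real.log_prod fun j _ => (hpos p j).ne'
  simp only [h1]
  have h2 : ∀ p j, tilt n y v p j - tilt n y v p j ^ 2 / 2 - 2 * δ * tilt n y v p j ^ 2 ≤
      Real.log (1 + tilt n y v p j) := fun p j => by
    have h := (abs_le.1 (abs_log_one_sub_add_le (u := -tilt n y v p j)
      (by simpa using hu p j) hδ)).1
    rw [sub_neg_eq_add] at h
    nlinarith
  refine le_trans (le_of_eq ?_)
    (Finset.sum_le_sum fun p _ => Finset.sum_le_sum fun j _ => h2 p j)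
  simp only [Finset.sum_sub_distrib, sum_tilt, ← Finset.mul_sum, ← Finset.sum_div,
    sum_tilt_sq hv]
  simp
  ring

/-- Weak duality: log x ≤ x - 1 at x = n_p w_{pj} (1 - u_{pj}). The sum of n_p w_{pj} u_{pj} equals
Q for every admissible w, and -∑ log(1 - u_{pj}) contributes about Q/2, so the total is about -Q +
Q/2. -/
theorem log_elRatio_le
    (hv : ∑ p, ((n p : ℝ)⁻¹ ^ 2) • ∑ j, (inner ℝ (y p j - sampleMean (y p)) v : ℝ) •
      (y p j - sampleMean (y p)) = ∑ p, sampleMean (y p))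
    {δ : ℝ} (hδ : δ ≤ 1 / 2) (hu : ∀ p j, |tilt n y v p j| ≤ δ) (hR : 0 < elRatio n y 0) :
    Real.log (elRatio n y 0) ≤ -(quadStat n y v) / 2 + 2 * δ * quadStat n y v := by
  have hne : (weights n y 0).Nonempty := by
    by_contra h
    rw [Set.not_nonempty_iff_eq_empty] at h
    simp [elRatio, h] at hR
  obtain ⟨w, ⟨hw, hw0⟩, hwR⟩ := (elRatio_isGreatest n y 0 hne).1
  rw [← hwR] at hR ⊢
  have hn0 : ∀ p j, (n p : ℝ) * w p j ≠ 0 := fun p j h => by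
    rw [likelihoodRatio, Finset.prod_eq_zero (Finset.mem_univ p)
      (Finset.prod_eq_zero (Finset.mem_univ j) h)] at hR
    exact lt_irrefl _ hR
  have hpos : ∀ p j, 0 < (n p : ℝ) * w p j := fun p j =>
    lt_of_le_of_ne (mul_nonneg (by positivity) ((hw p).1 j)) (hn0 p j).symm
  rw [likelihoodRatio, Real.log_prod fun p _ => (Finset.prod_pos fun j _ => hpos p j).ne']
  have h1 : ∀ p, Real.log (∏ j, ((n p : ℝ) * w p j)) = ∑ j, Real.log ((n p : ℝ) * w p j) :=
    fun p => Real.log_prod fun j _ => hn0 p j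
  simp only [h1]
  have h2 : ∀ p j, Real.log ((n p : ℝ) * w p j) ≤ n p * w p j - 1 +
      w p j * inner ℝ (y p j - sampleMean (y p)) v + tilt n y v p j + tilt n y v p j ^ 2 / 2 +
      2 * δ * tilt n y v p j ^ 2 := fun p j => by
    have h := (abs_le.1 (abs_log_one_sub_add_le (hu p j) hδ)).1
    have hu1 : 0 < 1 - tilt n y v p j := by
      have := (abs_le.1 (hu p j)).2
      linarith
    have h3 := Real.log_le_sub_one_of_pos (mul_pos (hpos p j) hu1)
    rw [Real.log_mul (hn0 p j) hu1.ne'] at h3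
    have h4 : n p * w p j * tilt n y v p j =
        -(w p j * inner ℝ (y p j - sampleMean (y p)) v) := by
      have : (n p : ℝ) ≠ 0 := fun h => hn0 p j (by simp [h])
      rw [tilt]
      field_simp
    nlinarith
  refine (Finset.sum_le_sum fun p _ => Finset.sum_le_sum fun j _ => h2 p j).trans (le_of_eq ?_)
  have h5 : ∑ p, ∑ j, w p j * inner ℝ (y p j - sampleMean (y p)) v = -quadStat n y v := by
    have h6 : ∀ p, ∑ j, w p j * inner ℝ (y p j - sampleMean (y p)) v =
        inner ℝ (∑ j, w p j • y p j) v - inner ℝ (sampleMean (y p)) v := fun p => by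
      simp only [inner_sub_left, mul_sub, Finset.sum_sub_distrib, ← Finset.sum_mul, (hw p).2,
        one_mul, sum_inner, real_inner_smul_left]
    simp only [h6, Finset.sum_sub_distrib, ← sum_inner]
    rw [hw0, quadStat]
    simp
  have h7 : ∀ p, ∑ j, ((n p : ℝ) * w p j) = n p := fun p => by
    rw [← Finset.mul_sum, (hw p).2, mul_one]
  simp only [Finset.sum_add_distrib, Finset.sum_sub_distrib, sum_tilt, ← Finset.mul_sum,
    ← Finset.sum_div, sum_tilt_sq hv, h5, (hw _).2]
  simp
  ring

/-- The deterministic expansion of the empirical likelihood ratio. -/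
theorem abs_neg_two_mul_log_elRatio_sub_le (hn : ∀ p, 0 < n p)
    (hv : ∑ p, ((n p : ℝ)⁻¹ ^ 2) • ∑ j, (inner ℝ (y p j - sampleMean (y p)) v : ℝ) •
      (y p j - sampleMean (y p)) = ∑ p, sampleMean (y p))
    {δ : ℝ} (hδ : δ ≤ 1 / 2) (hu : ∀ p j, |tilt n y v p j| ≤ δ) :
    0 < elRatio n y 0 ∧
      |-2 * Real.log (elRatio n y 0) - quadStat n y v| ≤ 4 * δ * quadStat n y v := by
  obtain ⟨hR, h1⟩ := le_log_elRatio hn hv hδ hu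
  have h2 := log_elRatio_le hv hδ hu hR
  refine ⟨hR, abs_le.2 ⟨?_, ?_⟩⟩ <;> linarith

end Bounds

/-! ### Rescaling: comparison of -2 log R(0) with ‖Z‖² -/

open InnerProductSpace in
/-- The covariance operator of the finite family `y`. -/
noncomputable def sampleCov {q k : ℕ} (y : Fin k → EuclideanSpace ℝ (Fin q)) :
    EuclideanSpace ℝ (Fin q) →L[ℝ] EuclideanSpace ℝ (Fin q) :=
  (k : ℝ)⁻¹ • ∑ j, rankOne ℝ (y j) (y j) - rankOne ℝ (sampleMean y) (sampleMean y)

/-- The uncentred definition suits the law of large numbers; the centred form is the one that occurs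
in `hv`. -/
theorem sampleCov_apply {q k : ℕ} (hk : 0 < k) (y : Fin k → EuclideanSpace ℝ (Fin q))
    (x : EuclideanSpace ℝ (Fin q)) :
    sampleCov y x = (k : ℝ)⁻¹ • ∑ j, (inner ℝ (y j - sampleMean y) x : ℝ) •
      (y j - sampleMean y) := by
  have h0 : (k : ℝ) ≠ 0 := by positivity
  have h1 : ∑ j, (inner ℝ (y j - sampleMean y) x : ℝ) • sampleMean y = 0 := by
    rw [← Finset.sum_smul, ← sum_inner, sum_sub_sampleMean, inner_zero_left, zero_smul]
  have h2 : ∑ j, (inner ℝ (sampleMean y) x : ℝ) • y j =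
      (k : ℝ) • (inner ℝ (sampleMean y) x : ℝ) • sampleMean y := by
    rw [← Finset.smul_sum, smul_comm, sampleMean, smul_inv_smul₀ h0]
  simp only [smul_sub, Finset.sum_sub_distrib]
  rw [h1]
  simp only [inner_sub_left, sub_smul, Finset.sum_sub_distrib]
  rw [h2, sampleCov]
  simp [smul_sub, smul_smul, h0]

section

variable {m q : ℕ} (n : Fin m → ℕ) (y : (p : Fin m) → Fin (n p) → EuclideanSpace ℝ (Fin q))

/-- The rescaled sum of the sample means. -/
noncomputable def scaledMean : EuclideanSpace ℝ (Fin q) :=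
  √(avgSize n) • ∑ p, sampleMean (y p)

/-- The estimated covariance operator of the rescaled sum of the sample means. -/
noncomputable def scaledCov : EuclideanSpace ℝ (Fin q) →L[ℝ] EuclideanSpace ℝ (Fin q) :=
  ∑ p, (avgSize n / n p) • sampleCov (y p)

variable {n y}

/-- Neumann series: M is invertible, and x - z = -(M - 1)x gives both estimates. -/
theorem exists_apply_eq_of_norm_sub_one_le {E : Type*} [NormedAddCommGroup E] [NormedSpace ℝ E]
    [CompleteSpace E] {M : E →L[ℝ] E} {ε : ℝ} (hε : ε ≤ 1 / 2) (hM : ‖M - 1‖ ≤ ε) (z : E) :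
    ∃ x, M x = z ∧ ‖x‖ ≤ 2 * ‖z‖ ∧ ‖x - z‖ ≤ 2 * ε * ‖z‖ := by
  have h1 : ‖1 - M‖ < 1 := by rw [norm_sub_rev]; linarith
  set U := Units.oneSub (1 - M) h1
  have hU : (U : E →L[ℝ] E) = M := by simp [U]
  refine ⟨(↑U⁻¹ : E →L[ℝ] E) z, ?_⟩
  set x := (↑U⁻¹ : E →L[ℝ] E) z
  have hx : M x = z := by
    have : ((U : E →L[ℝ] E) * (↑U⁻¹ : E →L[ℝ] E)) z = z := by simp
    rwa [hU] at this
  have h2 : ‖x - z‖ ≤ ε * ‖x‖ := by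
    have : x - z = -((M - 1) x) := by simp [hx]
    rw [this, norm_neg]
    exact ((M - 1).le_opNorm x).trans (by gcongr)
  have h3 : ‖x‖ ≤ 2 * ‖z‖ := by
    have : ‖x‖ ≤ ‖x - z‖ + ‖z‖ := by simpa using norm_add_le (x - z) z
    nlinarith [norm_nonneg x]
  have hε0 : 0 ≤ ε := (norm_nonneg _).trans hM
  exact ⟨hx, h3, h2.trans (by nlinarith)⟩

theorem norm_sampleMean_le {k : ℕ} {y : Fin k → EuclideanSpace ℝ (Fin q)} {c : ℝ} (hc : 0 ≤ c)
    (hy : ∀ j, ‖y j‖ ≤ c) : ‖sampleMean y‖ ≤ c := by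
  rw [sampleMean, norm_smul, norm_inv, Real.norm_natCast]
  rcases Nat.eq_zero_or_pos k with rfl | hk
  · simpa using hc
  · have h0 : (0 : ℝ) < k := by positivity
    rw [inv_mul_le_iff₀ h0]
    simpa using norm_sum_le_of_le Finset.univ fun j _ => hy j

/-- Non-asymptotic comparison of `-2 log R(0)` with the squared norm of the scaled mean. -/
theorem abs_neg_two_mul_log_elRatio_sub_norm_sq_le (hn : ∀ p, 0 < n p) (ha : 0 < avgSize n)
    {ε K B : ℝ} (hε0 : 0 ≤ ε) (hB : 0 ≤ B) (hK : 0 ≤ K) (hε : ε ≤ 1 / 2)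
    (hεKB : 4 * ε * K * B ≤ 1 / 2)
    (hM : ‖scaledCov n y - 1‖ ≤ ε) (hy : ∀ p j, ‖y p j‖ ≤ ε * √(n p))
    (hnB : ∀ p, √(avgSize n) ≤ B * √(n p)) (hZ : ‖scaledMean n y‖ ≤ K) :
    0 < elRatio n y 0 ∧ |-2 * Real.log (elRatio n y 0) - ‖scaledMean n y‖ ^ 2| ≤
      ε * (32 * K ^ 3 * B + 2 * K ^ 2) := by
  obtain ⟨x, hx, hx1, hx2⟩ := exists_apply_eq_of_norm_sub_one_le hε hM (scaledMean n y)
  set a := avgSize n with ha_def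
  have hsa : 0 < √a := Real.sqrt_pos.2 ha
  have hxK : ‖x‖ ≤ 2 * K := hx1.trans (by linarith)
  -- The factor √a turns M x = Z into the equation `hv`.
  set v := √a • x with hv_def
  have hv : ∑ p, ((n p : ℝ)⁻¹ ^ 2) • ∑ j, (inner ℝ (y p j - sampleMean (y p)) v : ℝ) •
      (y p j - sampleMean (y p)) = ∑ p, sampleMean (y p) := by
    have h1 : ∀ p, ((n p : ℝ)⁻¹ ^ 2) • ∑ j, (inner ℝ (y p j - sampleMean (y p)) v : ℝ) •
        (y p j - sampleMean (y p)) = (√a)⁻¹ • (a / n p) • sampleCov (y p) x := by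
      intro p
      rw [sampleCov_apply (hn p)]
      simp only [hv_def, real_inner_smul_right, mul_smul, ← Finset.smul_sum]
      simp only [smul_smul]
      congr 1
      have : (n p : ℝ) ≠ 0 := by exact_mod_cast (hn p).ne'
      field_simp
      rw [Real.sq_sqrt ha.le]
    have h2 : ∑ p, (a / n p) • sampleCov (y p) x = scaledMean n y := by
      rw [← hx, scaledCov]
      simp [a]
    simp only [h1, ← Finset.smul_sum, h2]
    rw [scaledMean, inv_smul_smul₀ hsa.ne']
  have hQ : quadStat n y v = inner ℝ (scaledMean n y) x := by
    rw [quadStat, hv_def, scaledMean, real_inner_smul_left, real_inner_smul_right]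
  -- The centred data are at most 2ε√n_p and ‖v‖ at most 2KB√n_p, so the division by n_p leaves
  -- 4εKB.
  have hu : ∀ p j, |tilt n y v p j| ≤ 4 * ε * K * B := by
    intro p j
    have hnp : (0 : ℝ) < n p := by exact_mod_cast hn p
    have hs : √(n p : ℝ) ^ 2 = n p := Real.sq_sqrt hnp.le
    have hs0 : 0 < √(n p : ℝ) := Real.sqrt_pos.2 hnp
    have h1 : ‖y p j - sampleMean (y p)‖ ≤ 2 * (ε * √(n p)) := by
      have := norm_sampleMean_le (by positivity) (hy p)
      have := norm_sub_le (y p j) (sampleMean (y p))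
      have := hy p j
      linarith
    have h2 : ‖v‖ ≤ B * √(n p) * (2 * K) := by
      rw [hv_def, norm_smul, Real.norm_of_nonneg hsa.le]
      exact mul_le_mul (hnB p) hxK (norm_nonneg _) (by positivity)
    rw [tilt, abs_neg, abs_div, abs_of_pos hnp, div_le_iff₀ hnp]
    calc |inner ℝ (y p j - sampleMean (y p)) v|
        ≤ ‖y p j - sampleMean (y p)‖ * ‖v‖ := abs_real_inner_le_norm _ _
      _ ≤ (2 * (ε * √(n p))) * (B * √(n p) * (2 * K)) :=
          mul_le_mul h1 h2 (norm_nonneg _) (by positivity)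
      _ = 4 * ε * K * B * √(n p) ^ 2 := by ring
      _ = 4 * ε * K * B * n p := by rw [hs]
  obtain ⟨hR, h⟩ := abs_neg_two_mul_log_elRatio_sub_le hn hv hεKB hu
  refine ⟨hR, ?_⟩
  rw [hQ] at h
  have h3 : (inner ℝ (scaledMean n y) x : ℝ) ≤ 2 * K ^ 2 := by
    refine (real_inner_le_norm _ _).trans ?_
    calc _ ≤ K * (2 * K) := mul_le_mul hZ hxK (norm_nonneg _) hK
      _ = _ := by ring
  have h4 : |inner ℝ (scaledMean n y) x - ‖scaledMean n y‖ ^ 2| ≤ ε * (2 * K ^ 2) := by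
    rw [← real_inner_self_eq_norm_sq, ← inner_sub_right]
    refine (abs_real_inner_le_norm _ _).trans ?_
    calc _ ≤ K * (2 * ε * K) :=
          mul_le_mul hZ (hx2.trans (by gcongr)) (norm_nonneg _) hK
      _ = _ := by ring
  have h5 : 4 * (4 * ε * K * B) * inner ℝ (scaledMean n y) x ≤ ε * (32 * K ^ 3 * B) := by
    calc _ ≤ 4 * (4 * ε * K * B) * (2 * K ^ 2) := by gcongr
      _ = _ := by ring
  have h6 := abs_add_le (-2 * Real.log (elRatio n y 0) - inner ℝ (scaledMean n y) x)
    (inner ℝ (scaledMean n y) x - ‖scaledMean n y‖ ^ 2)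
  rw [sub_add_sub_cancel] at h6
  linarith

end

/-- The sample of sizes `n` from the sequences `y`. -/
def sample {m q : ℕ} (n : Fin m → ℕ) (y : Fin m → ℕ → EuclideanSpace ℝ (Fin q)) (p : Fin m)
    (j : Fin (n p)) : EuclideanSpace ℝ (Fin q) := y p j

/-- A statement about one fixed realization: B depends only on the β_p, and ε is chosen after K, B
and η. -/
theorem eventually_abs_sub_norm_sq_le {m q : ℕ} {N : ℕ → Fin m → ℕ} {β : Fin m → ℝ}
    (hN : Tendsto (fun t => avgSize (N t)) atTop atTop) (hβpos : ∀ p, 0 < β p)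
    (hβ : ∀ p, Tendsto (fun t => (N t p : ℝ) / avgSize (N t)) atTop (𝓝 (β p)))
    {y : Fin m → ℕ → EuclideanSpace ℝ (Fin q)}
    (hM : Tendsto (fun t => scaledCov (N t) (sample (N t) y)) atTop (𝓝 1))
    (hy : ∀ p, ∀ ε > 0, ∀ᶠ k : ℕ in atTop, ∀ j < k, ‖y p j‖ ≤ ε * √k)
    (hNp : ∀ p, Tendsto (fun t => N t p) atTop atTop)
    {K η : ℝ} (hK : 0 ≤ K) (hη : 0 < η) :
    ∀ᶠ t in atTop, ‖scaledMean (N t) (sample (N t) y)‖ ≤ K →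
      0 < elRatio (N t) (sample (N t) y) 0 ∧
      |-2 * Real.log (elRatio (N t) (sample (N t) y) 0) -
        ‖scaledMean (N t) (sample (N t) y)‖ ^ 2| ≤ η := by
  obtain ⟨B, hB0, hB⟩ : ∃ B : ℝ, 0 ≤ B ∧
      ∀ᶠ t in atTop, ∀ p, √(avgSize (N t)) ≤ B * √(N t p) := by
    -- Eventually a / n_p ≤ 2 / β_p; summing over p gives one constant for all samples.
    refine ⟨√(∑ p, 2 / β p), Real.sqrt_nonneg _, eventually_all.2 fun p => ?_⟩
    filter_upwards [(hβ p).eventually (lt_mem_nhds (half_lt_self (hβpos p))),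
      hN.eventually_gt_atTop 0] with t h1 h2
    rw [← Real.sqrt_mul (Finset.sum_nonneg fun p _ => (div_pos two_pos (hβpos p)).le)]
    refine Real.sqrt_le_sqrt ?_
    have h3 : 2 / β p ≤ ∑ p, 2 / β p :=
      Finset.single_le_sum (f := fun p => 2 / β p)
        (fun p _ => (div_pos two_pos (hβpos p)).le) (Finset.mem_univ p)
    refine le_trans ?_ (mul_le_mul_of_nonneg_right h3 (Nat.cast_nonneg _))
    rw [lt_div_iff₀ h2] at h1
    rw [div_mul_eq_mul_div, le_div_iff₀ (hβpos p)]
    linarith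
  obtain ⟨ε, hε0, h1, h2, h3⟩ : ∃ ε : ℝ, 0 < ε ∧ ε ≤ 1 / 2 ∧ 4 * ε * K * B ≤ 1 / 2 ∧
      ε * (32 * K ^ 3 * B + 2 * K ^ 2) ≤ η := by
    have hc : ∀ c d : ℝ, 0 < d → ∀ᶠ ε in 𝓝[>] (0 : ℝ), ε * c ≤ d := fun c d hd => by
      have : Tendsto (fun ε : ℝ => ε * c) (𝓝[>] 0) (𝓝 0) := by
        have := (continuous_mul_const c).tendsto (0 : ℝ)
        rw [zero_mul] at this
        exact this.mono_left nhdsWithin_le_nhds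
      exact this.eventually (ge_mem_nhds hd)
    obtain ⟨ε, hε0, h1, h2, h3⟩ := ((eventually_mem_nhdsWithin (a := (0 : ℝ)) (s := Set.Ioi 0)).and
      ((hc 1 (1 / 2) (by norm_num)).and
      ((hc (4 * K * B) (1 / 2) (by norm_num)).and
        (hc (32 * K ^ 3 * B + 2 * K ^ 2) η hη)))).exists
    exact ⟨ε, hε0, by linarith, by linarith, h3⟩
  have hM' : ∀ᶠ t in atTop, ‖scaledCov (N t) (sample (N t) y) - 1‖ ≤ ε := by
    filter_upwards [hM.eventually (Metric.closedBall_mem_nhds 1 hε0)] with t ht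
    simpa [dist_eq_norm] using ht
  filter_upwards [hB, hM', hN.eventually_gt_atTop 0,
    eventually_all.2 fun p => (hNp p).eventually_gt_atTop 0,
    eventually_all.2 fun p => (hNp p).eventually (hy p ε hε0)] with t hBt hMt hat hnt hyt hZ
  obtain ⟨hR, h⟩ := abs_neg_two_mul_log_elRatio_sub_norm_sq_le hnt hat hε0.le hB0 hK h1 h2 hMt
    (fun p j => hyt p j j.2) hBt hZ
  exact ⟨hR, h.trans h3⟩

/-! ### Convergence in distribution from almost sure statements on bounded events -/

section Distribution

variable {Ω Ω' E : Type*} [MeasurableSpace Ω] [MeasurableSpace Ω'] {P : Measure Ω}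
  {P' : Measure Ω'} [IsProbabilityMeasure P] [IsProbabilityMeasure P']

theorem tendsto_measure_zero_of_ae_eventually_notMem {B : ℕ → Set Ω}
    (hB : ∀ t, NullMeasurableSet (B t) P) (h : ∀ᵐ ω ∂P, ∀ᶠ t in atTop, ω ∉ B t) :
    Tendsto (fun t => P (B t)) atTop (𝓝 0) := by
  have h1 : TendstoInMeasure P (fun t => (B t).indicator fun _ => (1 : ℝ)) atTop fun _ => 0 := by
    refine tendstoInMeasure_of_tendsto_ae
      (fun t => (aestronglyMeasurable_indicator_iff₀ (hB t)).2 aestronglyMeasurable_const) ?_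
    filter_upwards [h] with ω hω
    refine tendsto_const_nhds.congr' ?_
    filter_upwards [hω] with t ht
    rw [Set.indicator_of_notMem ht]
  refine (h1 1 one_pos).congr fun t => ?_
  congr 1
  ext ω
  by_cases hω : ω ∈ B t <;> simp [hω]

/-- A sequence that converges in distribution is bounded in probability. -/
theorem exists_measure_norm_gt_le [NormedAddCommGroup E] [NormedSpace ℝ E] [FiniteDimensional ℝ E]
    [MeasurableSpace E] [BorelSpace E] {Z : ℕ → Ω → E} {G : Ω' → E}
    (hZ : TendstoInDistribution Z atTop G (fun _ => P) P') {δ : ENNReal} (hδ : 0 < δ) :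
    ∃ K : ℝ, 0 ≤ K ∧ ∀ t, P {ω | K < ‖Z t ω‖} ≤ δ := by
  have := FiniteDimensional.proper_real E
  -- A convergent sequence together with its limit is compact, and the converse half of Prokhorov's
  -- theorem gives tightness.
  have hc := hZ.tendsto.isCompact_insert_range.closure
  have h1 := tendsto_measure_norm_gt_of_isTightMeasureSet (isTightMeasureSet_of_isCompact_closure hc)
  obtain ⟨K, hK, hK0⟩ := ((h1.eventually (ge_mem_nhds hδ)).and (eventually_ge_atTop 0)).exists
  refine ⟨K, hK0, fun t => ?_⟩
  have h2 : P.map (Z t) {x | K < ‖x‖} ≤ δ := by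
    refine le_trans ?_ hK
    refine le_iSup₂_of_le (P.map (Z t)) ?_ le_rfl
    exact ⟨⟨P.map (Z t), Measure.isProbabilityMeasure_map (hZ.forall_aemeasurable t)⟩,
      Set.mem_insert_of_mem _ ⟨t, rfl⟩, rfl⟩
  rwa [Measure.map_apply_of_aemeasurable (hZ.forall_aemeasurable t)
    (measurableSet_lt measurable_const measurable_norm)] at h2

/-- Tightness makes {‖Z t‖ > K} small uniformly in t; on the rest, the almost sure statement for
that fixed K applies. -/
theorem tendsto_measure_compl_of_ae_eventually [NormedAddCommGroup E] [NormedSpace ℝ E]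
    [FiniteDimensional ℝ E] [MeasurableSpace E] [BorelSpace E] {Z : ℕ → Ω → E} {G : Ω' → E}
    (hZ : TendstoInDistribution Z atTop G (fun _ => P) P') {S : ℕ → Set Ω}
    (hS : ∀ t, NullMeasurableSet (S t) P)
    (h : ∀ K : ℝ, 0 ≤ K → ∀ᵐ ω ∂P, ∀ᶠ t in atTop, ‖Z t ω‖ ≤ K → ω ∈ S t) :
    Tendsto (fun t => P (S t)ᶜ) atTop (𝓝 0) := by
  rw [ENNReal.tendsto_nhds_zero]
  intro δ hδ
  obtain ⟨K, hK0, hK⟩ := exists_measure_norm_gt_le hZ (ENNReal.half_pos hδ.ne')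
  have h1 : ∀ t, NullMeasurableSet ({ω | ‖Z t ω‖ ≤ K} \ S t) P := fun t =>
    (nullMeasurableSet_le (hZ.forall_aemeasurable t).norm aemeasurable_const).diff (hS t)
  have h2 := tendsto_measure_zero_of_ae_eventually_notMem h1 (by
    filter_upwards [h K hK0] with ω hω
    filter_upwards [hω] with t ht
    exact fun hb => hb.2 (ht hb.1))
  filter_upwards [h2.eventually (ge_mem_nhds (ENNReal.half_pos hδ.ne'))] with t ht
  calc P (S t)ᶜ ≤ P ({ω | K < ‖Z t ω‖} ∪ ({ω | ‖Z t ω‖ ≤ K} \ S t)) := by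
        refine measure_mono fun ω hω => ?_
        rcases lt_or_ge K ‖Z t ω‖ with hk | hk
        · exact Or.inl hk
        · exact Or.inr ⟨hk, hω⟩
    _ ≤ δ / 2 + δ / 2 := (measure_union_le _ _).trans (add_le_add (hK t) ht)
    _ = δ := ENNReal.add_halves δ

/-- Convergence in distribution is unaffected by changes on events of vanishing probability. -/
theorem tendstoInDistribution_of_tendsto_measure_ne [TopologicalSpace E] [MeasurableSpace E]
    [OpensMeasurableSpace E] {X X' : ℕ → Ω → E} {G : Ω' → E}
    (hX : TendstoInDistribution X atTop G (fun _ => P) P') (hX' : ∀ t, AEMeasurable (X' t) P)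
    {S : ℕ → Set Ω} (h : ∀ t, ∀ ω ∈ S t, X t ω = X' t ω)
    (hne : Tendsto (fun t => P (S t)ᶜ) atTop (𝓝 0)) :
    TendstoInDistribution X' atTop G (fun _ => P) P' where
  forall_aemeasurable := hX'
  aemeasurable_limit := hX.aemeasurable_limit
  tendsto := by
    have h0 := ProbabilityMeasure.tendsto_iff_forall_integral_tendsto.1 hX.tendsto
    refine ProbabilityMeasure.tendsto_iff_forall_integral_tendsto.2 fun f => ?_
    have h1 : ∀ {W : ℕ → Ω → E} (hW : ∀ t, AEMeasurable (W t) P) (t : ℕ),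
        ∫ x, f x ∂(P.map (W t)) = ∫ ω, f (W t ω) ∂P := fun hW t =>
      integral_map (hW t) f.continuous.measurable.aestronglyMeasurable
    have hi : ∀ {W : ℕ → Ω → E} (hW : ∀ t, AEMeasurable (W t) P) (t : ℕ),
        Integrable (fun ω => f (W t ω)) P := fun hW t =>
      Integrable.of_bound (f.continuous.measurable.comp_aemeasurable (hW t)).aestronglyMeasurable
        ‖f‖ (ae_of_all _ fun ω => f.norm_coe_le_norm _)
    specialize h0 f
    simp only [ProbabilityMeasure.coe_mk] at h0 ⊢
    simp only [h1 hX.forall_aemeasurable] at h0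
    simp only [h1 hX']
    have h2 : Tendsto (fun t => ∫ ω, f (X' t ω) ∂P - ∫ ω, f (X t ω) ∂P) atTop (𝓝 0) := by
      have h3 : Tendsto (fun t => 2 * ‖f‖ * P.real (S t)ᶜ) atTop (𝓝 0) := by
        have := ((ENNReal.tendsto_toReal ENNReal.zero_ne_top).comp hne).const_mul (2 * ‖f‖)
        simpa [Measure.real] using this
      refine squeeze_zero_norm (fun t => ?_) h3
      rw [← integral_sub (hi hX' t) (hi hX.forall_aemeasurable t)]
      have h4 : ∫ ω, (f (X' t ω) - f (X t ω)) ∂P = ∫ ω in (S t)ᶜ, (f (X' t ω) - f (X t ω)) ∂P := by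
        rw [setIntegral_eq_integral_of_forall_compl_eq_zero]
        intro ω hω
        rw [h t ω (by simpa using hω), sub_self]
      rw [h4]
      refine norm_setIntegral_le_of_norm_le_const (measure_lt_top _ _) fun ω _ => ?_
      refine (norm_sub_le _ _).trans ?_
      have := f.norm_coe_le_norm (X' t ω)
      have := f.norm_coe_le_norm (X t ω)
      linarith
    simpa using h2.add h0

/-- A delta-type principle for statistics with values in `[-∞, ∞]`. -/
theorem tendstoInDistribution_ereal [NormedAddCommGroup E] [NormedSpace ℝ E]
    [FiniteDimensional ℝ E] [MeasurableSpace E] [BorelSpace E] {Z : ℕ → Ω → E} {G : Ω' → E}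
    (hZ : TendstoInDistribution Z atTop G (fun _ => P) P') {g : E → ℝ} (hg : Continuous g)
    {F : ℕ → Ω → EReal} (hF : ∀ t, AEMeasurable (F t) P)
    (h : ∀ K : ℝ, 0 ≤ K → ∀ η : ℝ, 0 < η → ∀ᵐ ω ∂P, ∀ᶠ t in atTop, ‖Z t ω‖ ≤ K →
      ((F t ω).toReal : EReal) = F t ω ∧ |(F t ω).toReal - g (Z t ω)| ≤ η) :
    TendstoInDistribution F atTop (fun ω => ((g (G ω) : ℝ) : EReal)) (fun _ => P) P' := by
  have hFr : ∀ t, AEMeasurable (fun ω => (F t ω).toReal) P := fun t => (hF t).ereal_toReal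
  have hgZ : ∀ t, AEMeasurable (fun ω => g (Z t ω)) P := fun t =>
    hg.measurable.comp_aemeasurable (hZ.forall_aemeasurable t)
  have h1 : TendstoInDistribution (fun t ω => (F t ω).toReal) atTop (fun ω => g (G ω))
      (fun _ => P) P' := by
    refine tendstoInDistribution_of_tendstoInMeasure_sub _ _ (hZ.continuous_comp hg) ?_ hFr
    rw [tendstoInMeasure_iff_norm]
    intro η hη
    refine tendsto_of_tendsto_of_tendsto_of_le_of_le tendsto_const_nhds
      (tendsto_measure_compl_of_ae_eventually hZ
        (S := fun t => {ω | |(F t ω).toReal - g (Z t ω)| ≤ η / 2}) (fun t => ?_) fun K hK => ?_)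
      (fun _ => zero_le) fun t => measure_mono fun ω hω => ?_
    · exact nullMeasurableSet_le ((hFr t).sub (hgZ t)).norm aemeasurable_const
    · filter_upwards [h K hK (η / 2) (half_pos hη)] with ω hω
      filter_upwards [hω] with t ht hk
      exact (ht hk).2
    · simp only [Set.mem_ofPred_eq, Pi.sub_apply, Function.comp_apply, Pi.zero_apply, sub_zero,
        Real.norm_eq_abs] at hω
      simp only [Set.mem_compl_iff, Set.mem_ofPred_eq, not_le]
      linarith
  -- `EReal.toReal` sends ±∞ to 0, so the coerced real part differs from `F t` only where `F t` is
  -- infinite.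
  have h2 := h1.continuous_comp (F := EReal) continuous_coe_real_ereal
  have hS : ∀ t, NullMeasurableSet {ω | ((F t ω).toReal : EReal) = F t ω} P := fun t =>
    nullMeasurableSet_eq_fun (hFr t).coe_real_ereal (hF t)
  refine tendstoInDistribution_of_tendsto_measure_ne h2 hF (fun t ω hω => hω)
    (tendsto_measure_compl_of_ae_eventually hZ hS fun K hK => ?_)
  filter_upwards [h K hK 1 one_pos] with ω hω
  filter_upwards [hω] with t ht hk
  exact (ht hk).1

end Distribution

/-! ### Measurability of the likelihood ratio -/

section Measurability

variable {m q : ℕ} (n : Fin m → ℕ) (μ : EuclideanSpace ℝ (Fin q))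

theorem elRatio_nonneg (y : (p : Fin m) → Fin (n p) → EuclideanSpace ℝ (Fin q)) :
    0 ≤ elRatio n y μ := by
  refine Real.sSup_nonneg ?_
  rintro _ ⟨w, hw, rfl⟩
  exact Finset.prod_nonneg fun p _ => Finset.prod_nonneg fun j _ =>
    mul_nonneg (Nat.cast_nonneg _) ((hw.1 p).1 j)

/-- The set is the projection, along the compact product of simplices, of a closed set of pairs (w,
y). Positivity of c excludes the default value 0 taken when no weights are admissible. -/
theorem isClosed_le_elRatio {c : ℝ} (hc : 0 < c) :
    IsClosed {y : (p : Fin m) → Fin (n p) → EuclideanSpace ℝ (Fin q) | c ≤ elRatio n y μ} := by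
  set K : Set ((p : Fin m) → Fin (n p) → ℝ) :=
    Set.univ.pi fun p : Fin m => stdSimplex ℝ (Fin (n p))
  have hK : IsCompact K := isCompact_univ_pi fun p => isCompact_stdSimplex ℝ (Fin (n p))
  have : CompactSpace K := isCompact_iff_compactSpace.1 hK
  have hcont : Continuous (likelihoodRatio n) := by
    unfold likelihoodRatio; fun_prop
  set T : Set (K × ((p : Fin m) → Fin (n p) → EuclideanSpace ℝ (Fin q))) :=
    {z | ∑ p, ∑ j, z.1.1 p j • z.2 p j = μ ∧ c ≤ likelihoodRatio n z.1.1}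
  have hT : IsClosed T := by
    refine IsClosed.inter (isClosed_eq ?_ continuous_const)
      (isClosed_le continuous_const (hcont.comp (continuous_subtype_val.comp continuous_fst)))
    refine continuous_finsetSum _ fun p _ => continuous_finsetSum _ fun j _ => ?_
    have h1 : Continuous fun z : K × ((p : Fin m) → Fin (n p) → EuclideanSpace ℝ (Fin q)) =>
        z.1.1 := continuous_subtype_val.comp continuous_fst
    have h2 : Continuous fun z : K × ((p : Fin m) → Fin (n p) → EuclideanSpace ℝ (Fin q)) =>
        z.1.1 p j := (continuous_apply j).comp ((continuous_apply p).comp h1)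
    exact h2.smul (by fun_prop)
  convert isClosedMap_snd_of_compactSpace _ hT using 1
  ext y
  constructor
  · intro (hy : c ≤ elRatio n y μ)
    have hne : (weights n y μ).Nonempty := by
      by_contra h
      rw [Set.not_nonempty_iff_eq_empty] at h
      simp [elRatio, h] at hy
      linarith
    obtain ⟨w, hw, hwR⟩ := (elRatio_isGreatest n y μ hne).1
    exact ⟨⟨⟨w, fun p _ => hw.1 p⟩, y⟩, ⟨hw.2, hy.trans hwR.ge⟩, rfl⟩
  · rintro ⟨⟨⟨w, hw⟩, y'⟩, ⟨h1, h2⟩, rfl⟩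
    have hmem : w ∈ weights n y' μ := ⟨fun p => hw p (Set.mem_univ p), h1⟩
    exact h2.trans ((elRatio_isGreatest n y' μ ⟨w, hmem⟩).2 ⟨w, hmem, rfl⟩)

theorem measurable_elRatio :
    Measurable fun y : (p : Fin m) → Fin (n p) → EuclideanSpace ℝ (Fin q) => elRatio n y μ := by
  refine measurable_of_Ici fun c => ?_
  rcases le_or_gt c 0 with hc | hc
  · convert MeasurableSet.univ using 1
    ext y
    simp [hc.trans (elRatio_nonneg n μ y)]
  · exact (isClosed_le_elRatio n μ hc).measurableSet

theorem antitone_neg_two_mul_log :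
    Antitone fun r : ℝ => (-2 : EReal) * ENNReal.log (ENNReal.ofReal r) := by
  intro r s h
  have h1 : ENNReal.log (ENNReal.ofReal r) ≤ ENNReal.log (ENNReal.ofReal s) :=
    ENNReal.log_monotone (ENNReal.ofReal_le_ofReal h)
  simp only [EReal.neg_mul]
  exact EReal.neg_le_neg_iff.2 (mul_le_mul_of_nonneg_left h1 (by norm_num))

theorem measurable_negTwoLogEL :
    Measurable fun y : (p : Fin m) → Fin (n p) → EuclideanSpace ℝ (Fin q) =>
      negTwoLogEL n y μ :=
  antitone_neg_two_mul_log.measurable.comp (measurable_elRatio n μ)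

theorem negTwoLogEL_eq_coe {n : Fin m → ℕ}
    {y : (p : Fin m) → Fin (n p) → EuclideanSpace ℝ (Fin q)} {μ : EuclideanSpace ℝ (Fin q)}
    (h : 0 < elRatio n y μ) :
    negTwoLogEL n y μ = ((-2 * Real.log (elRatio n y μ) : ℝ) : EReal) := by
  rw [negTwoLogEL, ENNReal.log_ofReal_of_pos h, EReal.coe_mul]
  rfl

end Measurability

/-! ### Almost sure limits for one sample -/

section LawOfLargeNumbers

variable {q : ℕ} {Ω : Type*} [MeasurableSpace Ω] {P : Measure Ω}
  {ξ : ℕ → Ω → EuclideanSpace ℝ (Fin q)}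

/-- Comparing consecutive averages gives ‖y_k‖² / (k + 1) → 0; the finitely many early terms are
absorbed as k grows. -/
theorem eventually_norm_le_of_tendsto_average {E : Type*} [SeminormedAddCommGroup E] {y : ℕ → E}
    {c : ℝ} (h : Tendsto (fun k : ℕ => (∑ j ∈ Finset.range k, ‖y j‖ ^ 2) / k) atTop (𝓝 c))
    {ε : ℝ} (hε : 0 < ε) : ∀ᶠ k : ℕ in atTop, ∀ j < k, ‖y j‖ ≤ ε * √k := by
  have h1 : Tendsto (fun k : ℕ => ‖y k‖ ^ 2 / (k + 1 : ℝ)) atTop (𝓝 0) := by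
    have h2 := ((tendsto_add_atTop_iff_nat 1).2 h).sub (h.mul (tendsto_natCast_div_add_atTop (1 : ℝ)))
    rw [mul_one, sub_self] at h2
    refine h2.congr' ?_
    filter_upwards [eventually_gt_atTop 0] with k hk
    have : (k : ℝ) ≠ 0 := by positivity
    have : (k + 1 : ℝ) ≠ 0 := by positivity
    rw [Finset.sum_range_succ]
    push_cast
    field_simp
    ring
  have hε2 : 0 < ε ^ 2 := by positivity
  obtain ⟨J, hJ⟩ := eventually_atTop.1 (h1.eventually (ge_mem_nhds hε2))
  have h3 : ∀ᶠ k : ℕ in atTop, ∀ j ∈ Finset.range J, ‖y j‖ ^ 2 ≤ ε ^ 2 * k :=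
    (Finset.eventually_all _).2 fun j _ =>
      (tendsto_natCast_atTop_atTop.const_mul_atTop hε2).eventually_ge_atTop _
  filter_upwards [h3] with k hk j hjk
  have h4 : ‖y j‖ ^ 2 ≤ ε ^ 2 * k := by
    rcases lt_or_ge j J with hj | hj
    · exact hk j (Finset.mem_range.2 hj)
    · have h5 := hJ j hj
      rw [div_le_iff₀ (by positivity)] at h5
      have : (j + 1 : ℝ) ≤ k := by exact_mod_cast hjk
      exact h5.trans (by gcongr)
  refine le_of_sq_le_sq ?_ (by positivity)
  rwa [mul_pow, Real.sq_sqrt (Nat.cast_nonneg k)]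

open InnerProductSpace

theorem continuous_rankOne_self (q : ℕ) :
    Continuous fun x : EuclideanSpace ℝ (Fin q) => rankOne ℝ x x := by
  simp only [rankOne_def]
  fun_prop

theorem integrable_rankOne {X : Ω → EuclideanSpace ℝ (Fin q)} (hX : MemLp X 2 P) :
    Integrable (fun ω => rankOne ℝ (X ω) (X ω)) P := by
  have hc := continuous_rankOne_self q
  refine (hX.integrable_norm_pow two_ne_zero).mono'
    (hc.comp_aestronglyMeasurable hX.aestronglyMeasurable) (ae_of_all _ fun ω => ?_)
  rw [norm_rankOne]
  simp [pow_two]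

theorem ae_eventually_norm_le (hL2 : MemLp (ξ 0) 2 P) (hindep : iIndepFun ξ P)
    (hident : ∀ j, IdentDistrib (ξ j) (ξ 0) P P) :
    ∀ᵐ ω ∂P, ∀ ε > 0, ∀ᶠ k : ℕ in atTop, ∀ j < k, ‖ξ j ω‖ ≤ ε * √k := by
  have h := strong_law_ae_real (fun j ω => ‖ξ j ω‖ ^ 2) (hL2.integrable_norm_pow two_ne_zero)
    (fun i j hij => (hindep.indepFun hij).comp (φ := fun x => ‖x‖ ^ 2) (ψ := fun x => ‖x‖ ^ 2)
      (by fun_prop) (by fun_prop))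
    (fun j => (hident j).comp (u := fun x => ‖x‖ ^ 2) (by fun_prop))
  filter_upwards [h] with ω hω ε hε
  exact eventually_norm_le_of_tendsto_average hω hε

theorem ae_tendsto_sampleCov [IsProbabilityMeasure P] (hL2 : MemLp (ξ 0) 2 P)
    (hmean : ∫ ω, ξ 0 ω ∂P = 0) (hindep : iIndepFun ξ P) (hident : ∀ j, IdentDistrib (ξ j) (ξ 0) P P) :
    ∀ᵐ ω ∂P, Tendsto (fun k : ℕ => sampleCov fun j : Fin k => ξ j ω) atTop
      (𝓝 (∫ ω, rankOne ℝ (ξ 0 ω) (ξ 0 ω) ∂P)) := by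
  have hc := continuous_rankOne_self q
  have h1 := strong_law_ae (fun j ω => rankOne ℝ (ξ j ω) (ξ j ω)) (integrable_rankOne hL2)
    (fun i j hij => (hindep.indepFun hij).comp hc.measurable hc.measurable)
    (fun j => (hident j).comp hc.measurable)
  have h2 := strong_law_ae ξ (hL2.integrable one_le_two)
    (fun i j hij => hindep.indepFun hij) hident
  filter_upwards [h1, h2] with ω h1 h2
  rw [hmean] at h2
  have h3 := h1.sub ((hc.tendsto _).comp h2)
  simp only [map_zero, sub_zero] at h3
  refine h3.congr fun k => ?_
  simp only [sampleCov, sampleMean, Function.comp_apply,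
    Fin.sum_univ_eq_sum_range (fun j => ξ j ω),
    Fin.sum_univ_eq_sum_range (fun j => rankOne ℝ (ξ j ω) (ξ j ω))]

end LawOfLargeNumbers

/-! ### Multi-sample central limit theorem -/

section CentralLimit

variable {m q : ℕ} {Ω : Type*} [MeasurableSpace Ω] {P : Measure Ω}

theorem tendsto_natCast_atTop_of_avgSize {N : ℕ → Fin m → ℕ} {β : Fin m → ℝ}
    (hN : Tendsto (fun t => avgSize (N t)) atTop atTop) (hβpos : ∀ p, 0 < β p)
    (hβ : ∀ p, Tendsto (fun t => (N t p : ℝ) / avgSize (N t)) atTop (𝓝 (β p))) (p : Fin m) :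
    Tendsto (fun t => N t p) atTop atTop := by
  rw [← tendsto_natCast_atTop_iff (R := ℝ)]
  refine ((hβ p).pos_mul_atTop (hβpos p) hN).congr' ?_
  filter_upwards [hN.eventually_gt_atTop 0] with t ht
  rw [div_mul_cancel₀ _ ht.ne']

/-- The central limit theorem for a real sample, along a sequence of sample sizes and with a
convergent sequence of scale factors, in terms of characteristic functions. -/
theorem tendsto_charFun_scaled_sum [IsProbabilityMeasure P] {X : ℕ → Ω → ℝ} (hX : MemLp (X 0) 2 P)
    (hmean : ∫ ω, X 0 ω ∂P = 0) (hindep : iIndepFun X P)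
    (hident : ∀ j, IdentDistrib (X j) (X 0) P P) {k : ℕ → ℕ} (hk : Tendsto k atTop atTop)
    {c : ℕ → ℝ} {b : ℝ} (hc : Tendsto c atTop (𝓝 b)) :
    Tendsto (fun t => charFun (P.map fun ω =>
      c t * ((√(k t))⁻¹ * ∑ j ∈ Finset.range (k t), X j ω)) 1) atTop
      (𝓝 (Complex.exp (-((b ^ 2 * ∫ ω, X 0 ω ^ 2 ∂P : ℝ) : ℂ) / 2))) := by
  have h0 := tendstoInDistribution_inv_sqrt_mul_sum_sub
    (P' := gaussianReal 0 Var[X 0; P].toNNReal) (Y := id) ⟨by fun_prop, by simp⟩ hX hindep hident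
  simp only [hmean, mul_zero, sub_zero] at h0
  have h1 : TendstoInDistribution
      (fun t ω => (√(k t))⁻¹ * ∑ j ∈ Finset.range (k t), X j ω) atTop id (fun _ => P)
      (gaussianReal 0 Var[X 0; P].toNNReal) :=
    ⟨fun t => h0.forall_aemeasurable _, h0.aemeasurable_limit, h0.tendsto.comp hk⟩
  -- Slutsky's theorem, with the deterministic `c t` viewed as constant random variables.
  have h2 := h1.continuous_comp_prodMk_of_tendstoInMeasure_const
    (g := fun z : ℝ × ℝ => z.2 * z.1) (by fun_prop) (Y := fun t _ => c t) (c := b)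
    (tendstoInMeasure_of_tendsto_ae (fun _ => aestronglyMeasurable_const) (ae_of_all _ fun _ => hc))
    (fun _ => aemeasurable_const)
  have h3 := ProbabilityMeasure.tendsto_iff_tendsto_charFun.1 h2.tendsto 1
  simp only [ProbabilityMeasure.coe_mk] at h3
  convert h3 using 2
  have h4 := charFun_map_mul (μ := gaussianReal 0 Var[X 0; P].toNNReal) b 1
  simp only [id]
  rw [h4, charFun_gaussianReal, variance_of_integral_eq_zero hX.aestronglyMeasurable.aemeasurable
    hmean, Real.coe_toNNReal _ (integral_nonneg fun ω => sq_nonneg _)]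
  push_cast
  congr 1
  simp
  ring

/-- The Cramér–Wold reduction: only real characteristic functions at 1 are needed. -/
theorem charFun_map_eq_charFun_map_inner {E : Type*} [NormedAddCommGroup E] [InnerProductSpace ℝ E]
    [MeasurableSpace E] [BorelSpace E] [SecondCountableTopology E] {Z : Ω → E}
    (hZ : AEMeasurable Z P) (x : E) :
    charFun (P.map Z) x = charFun (P.map fun ω => (inner ℝ (Z ω) x : ℝ)) 1 := by
  rw [charFun_apply, charFun_apply, integral_map hZ (by fun_prop),
    integral_map (hZ.inner aemeasurable_const) (by fun_prop)]
  simp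

/-- The multi-sample central limit theorem for standardized data. -/
theorem tendstoInDistribution_scaledMean [IsProbabilityMeasure P]
    {ξ : Fin m → ℕ → Ω → EuclideanSpace ℝ (Fin q)}
    (hL2 : ∀ p, MemLp (ξ p 0) 2 P) (hmean : ∀ p, ∫ ω, ξ p 0 ω ∂P = 0)
    (hident : ∀ p j, IdentDistrib (ξ p j) (ξ p 0) P P)
    (hindep : iIndepFun (fun pj : Fin m × ℕ => ξ pj.1 pj.2) P)
    {N : ℕ → Fin m → ℕ} {β : Fin m → ℝ}
    (hN : Tendsto (fun t => avgSize (N t)) atTop atTop) (hβpos : ∀ p, 0 < β p)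
    (hβ : ∀ p, Tendsto (fun t => (N t p : ℝ) / avgSize (N t)) atTop (𝓝 (β p)))
    (hcov : ∀ x, ∑ p, (β p)⁻¹ * ∫ ω, (inner ℝ (ξ p 0 ω) x : ℝ) ^ 2 ∂P = ‖x‖ ^ 2) :
    TendstoInDistribution
      (fun t ω => scaledMean (N t) (sample (N t) fun p j => ξ p j ω)) atTop id (fun _ => P)
      (stdGaussian (EuclideanSpace ℝ (Fin q))) where
  forall_aemeasurable t := by
    have := fun p j => (hident p j).aemeasurable_fst
    simp only [scaledMean, sampleMean, sample]
    fun_prop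
  aemeasurable_limit := aemeasurable_id
  tendsto := by
    have hm : ∀ p j, AEMeasurable (ξ p j) P := fun p j => (hident p j).aemeasurable_fst
    refine ProbabilityMeasure.tendsto_iff_tendsto_charFun.2 fun x => ?_
    simp only [ProbabilityMeasure.coe_mk, Measure.map_id, charFun_stdGaussian]
    set X : Fin m → ℕ → Ω → ℝ := fun p j ω => inner ℝ (ξ p j ω) x with hX
    have hmX : ∀ p j, AEMeasurable (X p j) P := fun p j => (hm p j).inner aemeasurable_const
    have hiX : iIndepFun (fun pj : Fin m × ℕ => X pj.1 pj.2) P :=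
      hindep.comp (fun _ z => inner ℝ z x) (fun _ => by fun_prop)
    have hNp := tendsto_natCast_atTop_of_avgSize hN hβpos hβ
    have h1 : ∀ p, Tendsto (fun t => charFun (P.map fun ω => √(avgSize (N t) / N t p) *
        ((√(N t p))⁻¹ * ∑ j ∈ Finset.range (N t p), X p j ω)) 1) atTop
        (𝓝 (Complex.exp (-((√(β p)⁻¹ ^ 2 * ∫ ω, X p 0 ω ^ 2 ∂P : ℝ) : ℂ) / 2))) := by
      intro p
      refine tendsto_charFun_scaled_sum ((hL2 p).inner_const x) ?_
        (hiX.precomp (g := fun j => (p, j)) fun i j h => by simpa using h)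
        (fun j => (hident p j).comp (u := fun z => inner ℝ z x) (by fun_prop)) (hNp p) ?_
      · simp only [hX, real_inner_comm x]
        rw [integral_inner ((hL2 p).integrable one_le_two), hmean p, inner_zero_right]
      · refine (Real.continuous_sqrt.tendsto _).comp (((hβ p).inv₀ (hβpos p).ne').congr fun t => ?_)
        rw [inv_div]
    have h2 := tendsto_finsetProd Finset.univ fun p _ => h1 p
    have h3 : ∏ p, Complex.exp (-((√(β p)⁻¹ ^ 2 * ∫ ω, X p 0 ω ^ 2 ∂P : ℝ) : ℂ) / 2) =
        Complex.exp (-‖x‖ ^ 2 / 2) := by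
      rw [← Complex.exp_sum, ← Finset.sum_div, Finset.sum_neg_distrib, ← Complex.ofReal_sum]
      have : ∀ p, √(β p)⁻¹ ^ 2 = (β p)⁻¹ := fun p => Real.sq_sqrt (inv_pos.2 (hβpos p)).le
      simp only [this, hX, hcov x]
      push_cast
      rfl
    rw [h3] at h2
    refine h2.congr' ?_
    filter_upwards [hN.eventually_gt_atTop 0] with t hat
    have hmZ : AEMeasurable (fun ω => scaledMean (N t) (sample (N t) fun p j => ξ p j ω)) P := by
      simp only [scaledMean, sampleMean, sample]
      fun_prop
    rw [charFun_map_eq_charFun_map_inner hmZ]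
    have h4 : (fun ω => (inner ℝ (scaledMean (N t) (sample (N t) fun p j => ξ p j ω)) x : ℝ)) =
        fun ω => ∑ s : (p : Fin m) × Fin (N t p), √(avgSize (N t)) / N t s.1 * X s.1 s.2 ω := by
      ext ω
      rw [Fintype.sum_sigma, scaledMean, real_inner_smul_left, sum_inner, Finset.mul_sum]
      refine Finset.sum_congr rfl fun p _ => ?_
      rw [sampleMean, real_inner_smul_left, sum_inner, Finset.mul_sum, Finset.mul_sum]
      refine Finset.sum_congr rfl fun j _ => ?_
      simp only [hX, sample]
      ring
    -- Independence over all pairs (p, j) factors the characteristic function completely; `hi6` then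
    -- regroups the factors of each sample.
    have hi5 : iIndepFun (fun (s : (p : Fin m) × Fin (N t p)) ω =>
        √(avgSize (N t)) / N t s.1 * X s.1 s.2 ω) P :=
      (hiX.precomp (g := fun s : (p : Fin m) × Fin (N t p) => (s.1, (s.2 : ℕ))) (by
        rintro ⟨p, i⟩ ⟨p', j⟩ h
        simp only [Prod.mk.injEq] at h
        obtain ⟨rfl, h⟩ := h
        simpa [Fin.ext_iff] using h)).comp
        (fun s z => √(avgSize (N t)) / N t s.1 * z) (fun _ => by fun_prop)
    rw [h4, hi5.charFun_map_fun_sum_eq_prod fun s => (hmX _ _).const_mul _, Finset.prod_apply,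
      Fintype.prod_sigma]
    refine Finset.prod_congr rfl fun p _ => ?_
    have hi6 : iIndepFun (fun (j : Fin (N t p)) ω => √(avgSize (N t)) / N t p * X p j ω) P :=
      (hiX.precomp (g := fun j : Fin (N t p) => (p, (j : ℕ))) fun i j h => by
        simpa [Fin.ext_iff] using h).comp (fun _ z => √(avgSize (N t)) / N t p * z)
        (fun _ => by fun_prop)
    have h7 := hi6.charFun_map_fun_sum_eq_prod fun j => (hmX _ _).const_mul _
    have h8 := congrFun h7 1
    rw [Finset.prod_apply] at h8
    rw [← h8]
    congr 3
    ext ω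
    rw [← Finset.mul_sum, Fin.sum_univ_eq_sum_range (fun j => X p j ω), ← mul_assoc,
      Real.sqrt_div hat.le, ← div_eq_mul_inv, div_div, Real.mul_self_sqrt (Nat.cast_nonneg _)]

end CentralLimit

/-! ### The limit theorem for standardized data -/

section Standardized

variable {m q : ℕ} {Ω : Type*} [MeasurableSpace Ω] {P : Measure Ω} [IsProbabilityMeasure P]

open InnerProductSpace in
theorem ae_tendsto_scaledCov {ξ : Fin m → ℕ → Ω → EuclideanSpace ℝ (Fin q)}
    (hL2 : ∀ p, MemLp (ξ p 0) 2 P) (hmean : ∀ p, ∫ ω, ξ p 0 ω ∂P = 0)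
    (hident : ∀ p j, IdentDistrib (ξ p j) (ξ p 0) P P)
    (hindep : ∀ p, iIndepFun (ξ p) P)
    {N : ℕ → Fin m → ℕ} {β : Fin m → ℝ} (hβpos : ∀ p, 0 < β p)
    (hβ : ∀ p, Tendsto (fun t => (N t p : ℝ) / avgSize (N t)) atTop (𝓝 (β p)))
    (hNp : ∀ p, Tendsto (fun t => N t p) atTop atTop)
    (hcov : ∀ x z, ∑ p, (β p)⁻¹ *
      ∫ ω, (inner ℝ (ξ p 0 ω) x : ℝ) * inner ℝ (ξ p 0 ω) z ∂P = inner ℝ x z) :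
    ∀ᵐ ω ∂P, Tendsto (fun t => scaledCov (N t) (sample (N t) fun p j => ξ p j ω)) atTop
      (𝓝 1) := by
  -- `hcov` is the weak form of this operator identity.
  have h1 : ∑ p, (β p)⁻¹ • ∫ ω, rankOne ℝ (ξ p 0 ω) (ξ p 0 ω) ∂P = 1 := by
    ext1 x
    refine ext_inner_right ℝ fun z => ?_
    rw [one_apply_eq_self, ← hcov x z]
    simp only [_root_.sum_apply, smul_apply, sum_inner, real_inner_smul_left]
    refine Finset.sum_congr rfl fun p _ => ?_
    have hi := integrable_rankOne (hL2 p)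
    rw [ContinuousLinearMap.integral_apply hi, real_inner_comm,
      ← integral_inner (hi.apply_continuousLinearMap x)]
    congr 1
    refine integral_congr_ae (ae_of_all _ fun ω => ?_)
    simp only [rankOne_apply, real_inner_smul_right]
    rw [real_inner_comm z]
  filter_upwards [ae_all_iff.2 fun p => ae_tendsto_sampleCov (hL2 p) (hmean p) (hindep p)
    (hident p)] with ω hω
  rw [← h1]
  refine tendsto_finsetSum _ fun p _ => ?_
  refine Tendsto.smul (((hβ p).inv₀ (hβpos p).ne').congr fun t => ?_) ((hω p).comp (hNp p))
  rw [inv_div]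

/-- The theorem for standardized data: the populations have mean zero and their asymptotic
covariances add up to the identity. -/
theorem tendstoInDistribution_negTwoLogEL_of_standardized
    {ξ : Fin m → ℕ → Ω → EuclideanSpace ℝ (Fin q)}
    (hL2 : ∀ p, MemLp (ξ p 0) 2 P) (hmean : ∀ p, ∫ ω, ξ p 0 ω ∂P = 0)
    (hident : ∀ p j, IdentDistrib (ξ p j) (ξ p 0) P P)
    (hindep : iIndepFun (fun pj : Fin m × ℕ => ξ pj.1 pj.2) P)
    {N : ℕ → Fin m → ℕ} {β : Fin m → ℝ}
    (hN : Tendsto (fun t => avgSize (N t)) atTop atTop) (hβpos : ∀ p, 0 < β p)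
    (hβ : ∀ p, Tendsto (fun t => (N t p : ℝ) / avgSize (N t)) atTop (𝓝 (β p)))
    (hcov : ∀ x z, ∑ p, (β p)⁻¹ *
      ∫ ω, (inner ℝ (ξ p 0 ω) x : ℝ) * inner ℝ (ξ p 0 ω) z ∂P = inner ℝ x z) :
    TendstoInDistribution
      (fun t ω => negTwoLogEL (N t) (sample (N t) fun p j => ξ p j ω) 0) atTop
      (fun z => ((‖z‖ ^ 2 : ℝ) : EReal)) (fun _ => P)
      (stdGaussian (EuclideanSpace ℝ (Fin q))) := by
  have hNp := tendsto_natCast_atTop_of_avgSize hN hβpos hβ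
  have hindep' : ∀ p, iIndepFun (ξ p) P := fun p =>
    hindep.precomp (g := fun j => (p, j)) fun i j h => by simpa using h
  have hZ := tendstoInDistribution_scaledMean hL2 hmean hident hindep hN hβpos hβ fun x => by
    simp only [pow_two, hcov x x]
    rw [real_inner_self_eq_norm_mul_norm]
  refine tendstoInDistribution_ereal hZ (g := fun z => ‖z‖ ^ 2) (by fun_prop) (fun t => ?_)
    fun K hK η hη => ?_
  · refine (measurable_negTwoLogEL (N t) 0).comp_aemeasurable ?_
    exact aemeasurable_pi_lambda _ fun p => aemeasurable_pi_lambda _ fun j =>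
      (hident p j).aemeasurable_fst
  · filter_upwards [ae_tendsto_scaledCov hL2 hmean hident hindep' hβpos hβ hNp hcov,
      ae_all_iff.2 fun p => ae_eventually_norm_le (hL2 p) (hindep' p) (hident p)] with ω h1 h2
    filter_upwards [eventually_abs_sub_norm_sq_le hN hβpos hβ h1 h2 hNp hK hη] with t ht hZK
    obtain ⟨hR, h⟩ := ht hZK
    rw [negTwoLogEL_eq_coe hR, EReal.toReal_coe]
    exact ⟨rfl, h⟩

end Standardized

/-! ### Reduction to standardized data -/

section Whitening

open scoped MatrixOrder Matrix.Norms.L2Operator in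
-- Factor S = BᵀB and take C = (Bᵀ)⁻¹.
theorem exists_isUnit_mul_mul_transpose_eq_one {q : ℕ} {S : Matrix (Fin q) (Fin q) ℝ}
    (hS : S.PosDef) : ∃ C : Matrix (Fin q) (Fin q) ℝ, IsUnit C ∧ C * S * C.transpose = 1 := by
  obtain ⟨B, hB⟩ := CStarAlgebra.nonneg_iff_eq_star_mul_self.mp hS.posSemidef.nonneg
  rw [Matrix.star_eq_conjTranspose, Matrix.conjTranspose_eq_transpose_of_trivial] at hB
  have hu : IsUnit B := by
    have h := hS.isUnit
    rw [Matrix.isUnit_iff_isUnit_det] at h ⊢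
    rw [hB, Matrix.det_mul] at h
    exact isUnit_of_mul_isUnit_right h
  have hd : IsUnit B.det := (Matrix.isUnit_iff_isUnit_det _).1 hu
  have hdT : IsUnit B.transpose.det := by rwa [Matrix.det_transpose]
  refine ⟨B.transpose⁻¹, ?_, ?_⟩
  · rw [Matrix.isUnit_nonsing_inv_iff, Matrix.isUnit_iff_isUnit_det]
    exact hdT
  · rw [hB, Matrix.transpose_nonsing_inv, Matrix.transpose_transpose,
      ← Matrix.mul_assoc, Matrix.nonsing_inv_mul _ hdT, Matrix.one_mul, Matrix.mul_nonsing_inv _ hd]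

theorem integral_inner_mul_inner {q : ℕ} {Ω : Type*} [MeasurableSpace Ω] {P : Measure Ω}
    [IsProbabilityMeasure P] {X : Ω → EuclideanSpace ℝ (Fin q)} (hX : MemLp X 2 P)
    (a b : EuclideanSpace ℝ (Fin q)) :
    ∫ ω, (inner ℝ (X ω - ∫ ω, X ω ∂P) a : ℝ) * inner ℝ (X ω - ∫ ω, X ω ∂P) b ∂P =
      a.ofLp ⬝ᵥ (covMatrix P X).mulVec b.ofLp := by
  have hXi : ∀ i, MemLp (fun ω => X ω i) 2 P := fun i =>
    (EuclideanSpace.proj (𝕜 := ℝ) i).comp_memLp' hX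
  have h1 : ∀ c : EuclideanSpace ℝ (Fin q), ∫ ω, (inner ℝ (X ω) c : ℝ) ∂P =
      inner ℝ (∫ ω, X ω ∂P) c := fun c => by
    simp only [real_inner_comm c]
    exact integral_inner (hX.integrable one_le_two) c
  have h2 : ∀ c : EuclideanSpace ℝ (Fin q), (fun ω => (inner ℝ (X ω) c : ℝ)) =
      fun ω => ∑ i, c i * X ω i := fun c => by
    ext ω
    simp [PiLp.inner_apply]
  have h3 : cov[fun ω => (inner ℝ (X ω) a : ℝ), fun ω => (inner ℝ (X ω) b : ℝ); P] =
      ∫ ω, (inner ℝ (X ω - ∫ ω, X ω ∂P) a : ℝ) * inner ℝ (X ω - ∫ ω, X ω ∂P) b ∂P := by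
    simp only [covariance, h1, inner_sub_left]
  rw [← h3, h2, h2, covariance_fun_sum_fun_sum (fun i => (hXi i).const_mul _)
    fun i => (hXi i).const_mul _]
  simp only [covariance_const_mul_left, covariance_const_mul_right, dotProduct, Matrix.mulVec,
    covMatrix, Matrix.of_apply, Finset.mul_sum]
  refine Finset.sum_congr rfl fun i _ => Finset.sum_congr rfl fun k _ => ?_
  ring

/-- The weights of each sample sum to 1, so shifting sample p by μ_p shifts the weighted sum by μ_p;
injectivity of `A` removes `A`. -/
theorem weights_affine {m q : ℕ} (n : Fin m → ℕ)
    (y : (p : Fin m) → Fin (n p) → EuclideanSpace ℝ (Fin q))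
    (μ : Fin m → EuclideanSpace ℝ (Fin q))
    {A : EuclideanSpace ℝ (Fin q) →L[ℝ] EuclideanSpace ℝ (Fin q)} (hA : Function.Injective A) :
    weights n (fun p j => A (y p j - μ p)) 0 = weights n y (∑ p, μ p) := by
  ext w
  refine and_congr_right fun hw => ?_
  have h1 : ∑ p, ∑ j, w p j • A (y p j - μ p) = A (∑ p, ∑ j, w p j • y p j - ∑ p, μ p) := by
    have h2 : ∀ p, ∑ j, w p j • μ p = μ p := fun p => by rw [← Finset.sum_smul, (hw p).2, one_smul]
    have h3 : ∑ p, ∑ j, w p j • y p j - ∑ p, μ p = ∑ p, ∑ j, w p j • (y p j - μ p) := by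
      simp only [smul_sub, Finset.sum_sub_distrib, h2]
    rw [h3]
    simp only [map_sum, map_smul]
  rw [h1, map_eq_zero_iff A hA, sub_eq_zero]

theorem map_norm_sq_stdGaussian (q : ℕ) :
    (stdGaussian (EuclideanSpace ℝ (Fin q))).map (fun z => ‖z‖ ^ 2) = chiSquare q := by
  rw [← map_pi_eq_stdGaussian, Measure.map_map (by fun_prop) (by fun_prop), chiSquare]
  congr 1
  ext z
  simp [EuclideanSpace.real_norm_sq_eq]

end Whitening

end MultiEL

theorem mainTheorem2 {m q : ℕ}
    -- the populations: random vectors `Y p` in `ℝ^q` with positive definite covariance matrices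
    {Ω₀ : Type*} [MeasurableSpace Ω₀] (P₀ : Measure Ω₀) [IsProbabilityMeasure P₀]
    (Y : Fin m → Ω₀ → EuclideanSpace ℝ (Fin q))
    (hL2 : ∀ p, MemLp (Y p) 2 P₀)
    (hcov : ∀ p, (MultiEL.covMatrix P₀ (Y p)).PosDef)
    -- the data: i.i.d. copies `Ys p 0, Ys p 1, …` of `Y p`, mutually independent across `p`
    {Ω : Type*} [MeasurableSpace Ω] (P : Measure Ω) [IsProbabilityMeasure P]
    (Ys : Fin m → ℕ → Ω → EuclideanSpace ℝ (Fin q))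
    (hident : ∀ p j, IdentDistrib (Ys p j) (Y p) P P₀)
    (hindep : iIndepFun (fun pj : Fin m × ℕ => Ys pj.1 pj.2) P)
    -- the sample sizes, along an arbitrary sequence whose average size tends to infinity
    (N : ℕ → Fin m → ℕ) (β : Fin m → ℝ)
    (hN : Tendsto (fun t => MultiEL.avgSize (N t)) atTop atTop)
    (hβpos : ∀ p, 0 < β p)
    (hβ : ∀ p, Tendsto (fun t => (N t p : ℝ) / MultiEL.avgSize (N t)) atTop (𝓝 (β p))) :
    TendstoInDistribution
      (fun t ω => MultiEL.negTwoLogEL (N t) (fun p j => Ys p j ω) (∑ p, ∫ ω₀, Y p ω₀ ∂P₀))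
      atTop (fun x : ℝ => (x : EReal)) (fun _ => P) (MultiEL.chiSquare q) := by
  have hm : Nonempty (Fin m) := by
    -- With m = 0 the average size would be constantly 0, against `hN`. Positive definiteness of the
    -- sum below needs at least one sample.
    by_contra h
    rw [not_nonempty_iff] at h
    obtain ⟨t, ht⟩ := (hN.eventually_gt_atTop 0).exists
    simp [MultiEL.avgSize] at ht
  have hS : (∑ p, (β p)⁻¹ • MultiEL.covMatrix P₀ (Y p)).PosDef :=
    Matrix.posDef_sum Finset.univ_nonempty fun p _ => (hcov p).smul (inv_pos.2 (hβpos p))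
  obtain ⟨C, hC, hCS⟩ := MultiEL.exists_isUnit_mul_mul_transpose_eq_one hS
  set A : EuclideanSpace ℝ (Fin q) →L[ℝ] EuclideanSpace ℝ (Fin q) :=
    Matrix.toEuclideanCLM (n := Fin q) (𝕜 := ℝ) C with hA
  have hAinj : Function.Injective A := by
    have hu : IsUnit A := hC.map (Matrix.toEuclideanCLM (n := Fin q) (𝕜 := ℝ))
    obtain ⟨U, hU⟩ := hu
    refine Function.LeftInverse.injective (g := (↑U⁻¹ : EuclideanSpace ℝ (Fin q) →L[ℝ] _))
      fun x => ?_
    rw [← hU, ← mul_apply_eq_comp, Units.inv_mul, one_apply_eq_self]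
  have hAadj : ∀ y x : EuclideanSpace ℝ (Fin q), (inner ℝ (A y) x : ℝ) =
      inner ℝ y (WithLp.toLp 2 (C.transpose.mulVec x.ofLp)) := fun y x => by
    rw [← ContinuousLinearMap.adjoint_inner_right, hA, ← ContinuousLinearMap.star_eq_adjoint,
      ← map_star]
    rfl
  set μ : Fin m → EuclideanSpace ℝ (Fin q) := fun p => ∫ ω₀, Y p ω₀ ∂P₀ with hμ
  set u : Fin m → EuclideanSpace ℝ (Fin q) → EuclideanSpace ℝ (Fin q) := fun p z => A (z - μ p)
  have hu : ∀ p, Measurable (u p) := fun p => by fun_prop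
  have hid : ∀ p j, IdentDistrib (fun ω => u p (Ys p j ω)) (fun ω => u p (Y p ω)) P P₀ :=
    fun p j => (hident p j).comp (hu p)
  have h := MultiEL.tendstoInDistribution_negTwoLogEL_of_standardized
    (ξ := fun p j ω => u p (Ys p j ω)) (P := P) (fun p => ?_) (fun p => ?_)
    (fun p j => (hid p j).trans (hid p 0).symm)
    (hindep.comp (fun pj => u pj.1) fun pj => hu pj.1) hN hβpos hβ (fun x z => ?_)
  · have h1 : ∀ t ω, MultiEL.negTwoLogEL (N t)
        (MultiEL.sample (N t) fun p j => u p (Ys p j ω)) 0 =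
        MultiEL.negTwoLogEL (N t) (fun p j => Ys p j ω) (∑ p, μ p) := fun t ω => by
      have := MultiEL.weights_affine (N t) (fun p j => Ys p j ω) μ hAinj
      simp only [MultiEL.negTwoLogEL, MultiEL.elRatio]
      rw [← this]
      rfl
    simp only [h1] at h
    refine ⟨h.forall_aemeasurable, measurable_coe_real_ereal.aemeasurable, ?_⟩
    convert h.tendsto using 1
    refine congrArg 𝓝 ?_
    refine Subtype.ext ?_
    change (MultiEL.chiSquare q).map _ = _
    rw [← MultiEL.map_norm_sq_stdGaussian, Measure.map_map measurable_coe_real_ereal (by fun_prop)]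
    rfl
  · exact (hid p 0).memLp_iff.2 (A.comp_memLp' ((hL2 p).sub (memLp_const _)))
  · have hi := (hL2 p).integrable one_le_two
    have h1 := A.integral_comp_comm (φ := fun ω => Y p ω - μ p) (hi.sub (integrable_const _))
    rw [(hid p 0).integral_eq, h1, integral_sub hi (integrable_const _)]
    simp [hμ]
  · have h2 : ∀ p, ∫ ω, (inner ℝ (u p (Ys p 0 ω)) x : ℝ) * inner ℝ (u p (Ys p 0 ω)) z ∂P =
        (C.transpose.mulVec x.ofLp) ⬝ᵥ
          (MultiEL.covMatrix P₀ (Y p)).mulVec (C.transpose.mulVec z.ofLp) := fun p => by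
      have h3 := ((hid p 0).comp (u := fun y => (inner ℝ y x : ℝ) * inner ℝ y z)
        (by fun_prop)).integral_eq
      simp only [Function.comp_def] at h3
      rw [h3]
      simp only [u, hAadj]
      exact MultiEL.integral_inner_mul_inner (hL2 p) _ _
    have h4 : ∑ p, (β p)⁻¹ * ((C.transpose.mulVec x.ofLp) ⬝ᵥ
        (MultiEL.covMatrix P₀ (Y p)).mulVec (C.transpose.mulVec z.ofLp)) =
        (C.transpose.mulVec x.ofLp) ⬝ᵥ (∑ p, (β p)⁻¹ • MultiEL.covMatrix P₀ (Y p)).mulVec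
          (C.transpose.mulVec z.ofLp) := by
      rw [Matrix.sum_mulVec, dotProduct_sum]
      simp only [Matrix.smul_mulVec, dotProduct_smul, smul_eq_mul]
    simp only [h2]
    -- The form is xᵀ(C S Cᵀ)z, and `hCS` reduces it to the inner product.
    rw [h4, Matrix.mulVec_mulVec, Matrix.mulVec_transpose, ← Matrix.dotProduct_mulVec,
      Matrix.mulVec_mulVec, ← Matrix.mul_assoc, hCS, Matrix.one_mulVec]
    simp [PiLp.inner_apply, dotProduct, mul_comm]
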